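/- Let $\mathsf T$ be an essentially small triangulated category. Suppose that - $\mathsf T$ is finitely generated, i.e. there is an object $X$ such that $\mathsf T$ is the smallest thick subcategory of $\mathsf T$ containing $X$; and - $\mathsf T$ is locally finite, i.e. both $\mathsf T$ and $\mathsf T^{\mathrm{op}}$ are locally noetherian. Then $\mathsf T$ has only finitely many thick subcategories. Here a thick subcategory is a full triangulated subcategory closed under direct summands (in particular, closed under isomorphisms). An additive category $\mathsf C$ is called locally noetherian if idempotents split in $\mathsf C$ and every object of $\mathbf A(\mathsf C)$ is noetherian, that is, every ascending chain of its subobjects in $\mathbf A(\mathsf C)$ stabilises, where $\mathbf A(\mathsf C)$ denotes the category of all additive functors $F\colon\mathsf C^{\mathrm{op}}\to\mathsf{Ab}$ that fit into an exact sequence $\operatorname{Hom}_{\mathsf C}(-,X)\to\operatorname{Hom}_{\mathsf C}(-,Y)\to F\to 0$ with $X,Y\in\mathsf C$. -/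

import Mathlib

open CategoryTheory CategoryTheory.Limits

universe w v u

namespace LocFinTriang

section Abelianization

variable (C : Type u) [Category.{v} C] [Preadditive C]

/-- The additive functors `F : Cᵒᵖ ⥤ Ab` which fit into an exact sequence
`Hom(-, X) ⟶ Hom(-, Y) ⟶ F ⟶ 0` of functors. -/
def isFinitelyPresented : ObjectProperty (Cᵒᵖ ⥤ AddCommGrpCat.{v}) := fun F =>
  F.Additive ∧
    ∃ (X Y : C) (f : preadditiveYoneda.obj X ⟶ preadditiveYoneda.obj Y)
      (p : preadditiveYoneda.obj Y ⟶ F) (w : f ≫ p = 0),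
      (ShortComplex.mk f p w).Exact ∧ Epi p

/-- The abelianization `A(C)`: the full subcategory of the category of functors `Cᵒᵖ ⥤ Ab`
on the finitely presented additive functors. -/
abbrev Abelianization := (isFinitelyPresented C).FullSubcategory

/-- `C` is locally noetherian: idempotents split in `C`, and every object of the abelianization
satisfies the ascending chain condition on its subobjects (in the abelianization). -/
structure IsLocallyNoetherian : Prop where
  idempotents_split : IsIdempotentComplete C
  noetherian : ∀ F : Abelianization C, IsNoetherianObject F

/-- `C` is locally finite: both `C` and `Cᵒᵖ` are locally noetherian. -/
structure IsLocallyFinite : Prop where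
  locallyNoetherian : IsLocallyNoetherian C
  locallyNoetherian_op : IsLocallyNoetherian Cᵒᵖ

end Abelianization

section Thick

variable {C : Type u} [Category.{v} C] [HasZeroObject C] [HasShift C ℤ]
  [Preadditive C] [∀ n : ℤ, (shiftFunctor C n).Additive] [Pretriangulated C]

/-- A thick subcategory, given by its class of objects: a full triangulated subcategory which is
closed under direct summands (in particular, closed under isomorphisms). -/
structure IsThick (P : ObjectProperty C) : Prop where
  isTriangulated : P.IsTriangulated
  retracts : P.IsStableUnderRetracts

/-- The smallest thick subcategory which contains all objects of `S`, that is, the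
intersection of all of them. -/
def thickClosure (S : ObjectProperty C) : ObjectProperty C := fun Y =>
  ∀ P : ObjectProperty C, IsThick P → S ≤ P → P Y

variable (C) in
/-- `C` is finitely generated: `C = Thick(X)` for a single object `X`. -/
def IsFinitelyGenerated : Prop :=
  ∃ X : C, thickClosure (ObjectProperty.singleton X) = ⊤

end Thick

end LocFinTriang

/-! Let `X` generate. A thick subcategory is determined by the indecomposables it contains that
receive a nonzero map from `X`, and these form finitely many isomorphism classes; so there are
finitely many thick subcategories.

Both halves use only chain conditions on morphisms. Images of maps between representables are
finitely presented, so local finiteness gives maximal morphisms into or out of an object, ordered by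
factorisation; passing to cones reverses this order and gives minimal ones. Fitting's lemma follows,
and indecomposables have local endomorphism rings.

Finiteness (`finite_indecomposable_from`) is the argument that a finite length object has finitely
many composition factors, applied to a minimal counterexample. Determination
(`le_of_indecomposable`) uses minimal approximations and Wakamatsu's lemma: for thick `Q ≤ P`, the
cone of a minimal `Q`-approximation of an object of `P` lies in `P` and is right orthogonal to `Q`,
and a nonzero such cone would have a shift with a summand among the indecomposables above. -/

namespace LocFinTriang

/-! ### Subobjects of representable functors and factorisation of morphisms -/

section ImageFunctor

variable {D : Type u} [Category.{v} D] [Preadditive D]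

/-- The image in the functor category of the morphism of representable functors given by `f`. -/
noncomputable abbrev imageFunctor {X Y : D} (f : Y ⟶ X) : Dᵒᵖ ⥤ AddCommGrpCat.{v} :=
  image (preadditiveYoneda.map f)

lemma factorThruImage_surjective {X Y : D} (f : Y ⟶ X) (T : Dᵒᵖ) :
    Function.Surjective ((factorThruImage (preadditiveYoneda.map f)).app T) := by
  have : Epi ((factorThruImage (preadditiveYoneda.map f)).app T) := inferInstance
  exact (AddCommGrpCat.epi_iff_surjective _).1 this

lemma additive_of_mono {F G : Dᵒᵖ ⥤ AddCommGrpCat.{v}} [G.Additive] (i : F ⟶ G) [Mono i] :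
    F.Additive where
  map_add {A B a b} := by
    rw [← cancel_mono (i.app B)]
    simp [NatTrans.naturality, Preadditive.add_comp, Preadditive.comp_add]

variable (D) in
/-- Every morphism has a weak kernel. -/
def HasWeakKernels : Prop :=
  ∀ ⦃Y X : D⦄ (f : Y ⟶ X), ∃ (W : D) (k : W ⟶ Y), k ≫ f = 0 ∧
    ∀ ⦃T : D⦄ (t : T ⟶ Y), t ≫ f = 0 → ∃ s : T ⟶ W, s ≫ k = t

/-- A weak kernel `W ⟶ Y` of `f` gives the presentation `Hom(-, W) ⟶ Hom(-, Y) ⟶ im ⟶ 0`. -/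
lemma isFinitelyPresented_imageFunctor (hD : HasWeakKernels D) {X Y : D} (f : Y ⟶ X) :
    isFinitelyPresented D (imageFunctor f) := by
  obtain ⟨W, k, hk, hW⟩ := hD f
  have w : preadditiveYoneda.map k ≫ factorThruImage (preadditiveYoneda.map f) = 0 := by
    rw [← cancel_mono (image.ι (preadditiveYoneda.map f)), Category.assoc, image.fac,
      ← Functor.map_comp, hk, Functor.map_zero, zero_comp]
  refine ⟨additive_of_mono (image.ι (preadditiveYoneda.map f)), W, Y, preadditiveYoneda.map k,
    factorThruImage (preadditiveYoneda.map f), w, ?_, inferInstance⟩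
  rw [ShortComplex.exact_iff_epi_kernel_lift, NatTrans.epi_iff_epi_app]
  intro T
  rw [AddCommGrpCat.epi_iff_surjective]
  intro z
  dsimp at z ⊢
  set p := factorThruImage (preadditiveYoneda.map f)
  let t : T.unop ⟶ Y := (kernel.ι p).app T z
  have ht : t ≫ f = 0 := by
    have h1 : kernel.ι p ≫ preadditiveYoneda.map f = 0 :=
      (congrArg (kernel.ι p ≫ ·) (image.fac (preadditiveYoneda.map f))).symm.trans
        ((kernel.condition_assoc p _).trans zero_comp)
    exact ConcreteCategory.congr_hom (NatTrans.congr_app h1 T) z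
  obtain ⟨s, hs⟩ := hW t ht
  refine ⟨s, ?_⟩
  have hinj : Function.Injective ((kernel.ι p).app T) :=
    (AddCommGrpCat.mono_iff_injective _).1 inferInstance
  apply hinj
  have h2 := ConcreteCategory.congr_hom
    (NatTrans.congr_app (kernel.lift_ι p (preadditiveYoneda.map k) w) T) s
  exact h2.trans hs

/-- Among the morphisms to `X` in a nonempty class there is a maximal one, for the preorder
"`f` factors through `g`". -/
lemma exists_maximal_of_isLocallyNoetherian (hD : HasWeakKernels D)
    (hN : IsLocallyNoetherian D) (X : D) (P : ∀ ⦃Y : D⦄, (Y ⟶ X) → Prop)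
    (hP : ∃ (Y : D) (f : Y ⟶ X), P f) :
    ∃ (Y : D) (f : Y ⟶ X), P f ∧ ∀ ⦃Z : D⦄ (g : Z ⟶ X), P g → (∃ h, h ≫ g = f) →
      ∃ h, h ≫ f = g := by
  have hid : isFinitelyPresented D (preadditiveYoneda.obj X) := by
    refine ⟨inferInstance, X, X, 0, 𝟙 _, by simp, ?_, inferInstance⟩
    rw [ShortComplex.exact_iff_mono _ rfl]
    dsimp
    infer_instance
  let A : Abelianization D := ⟨preadditiveYoneda.obj X, hid⟩
  let B {Y : D} (f : Y ⟶ X) : Abelianization D :=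
    ⟨imageFunctor f, isFinitelyPresented_imageFunctor hD f⟩
  let i {Y : D} (f : Y ⟶ X) : B f ⟶ A := ⟨image.ι (preadditiveYoneda.map f)⟩
  have hi {Y : D} (f : Y ⟶ X) : Mono (i f) := by
    have : Mono ((isFinitelyPresented D).ι.map (i f)) :=
      inferInstanceAs (Mono (image.ι (preadditiveYoneda.map f)))
    exact (isFinitelyPresented D).ι.mono_of_mono_map this
  -- By Yoneda: an inclusion of images sends the class of `𝟙 Y` to an element that lifts to a map `Y
  -- ⟶ Z`, which is the factorisation.
  have hle {Y Z : D} (f : Y ⟶ X) (g : Z ⟶ X) :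
      Subobject.mk (i f) ≤ Subobject.mk (i g) ↔ ∃ h, h ≫ g = f := by
    constructor
    · intro h
      let φ := Subobject.ofMkLEMk (i f) (i g) h
      have hφ : φ ≫ i g = i f := Subobject.ofMkLEMk_comp h
      have hφ' : φ.hom ≫ image.ι (preadditiveYoneda.map g) = image.ι (preadditiveYoneda.map f) :=
        congr_arg (fun a => a.hom) hφ
      obtain ⟨y, hy⟩ := factorThruImage_surjective g (.op Y)
        (φ.hom.app (.op Y) ((factorThruImage (preadditiveYoneda.map f)).app (.op Y) (𝟙 Y : Y ⟶ Y)))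
      refine ⟨y, ?_⟩
      have h1 := ConcreteCategory.congr_hom
        (NatTrans.congr_app (image.fac (preadditiveYoneda.map g)) (.op Y)) y
      have h2 := ConcreteCategory.congr_hom
        (NatTrans.congr_app (image.fac (preadditiveYoneda.map f)) (.op Y)) (𝟙 Y : Y ⟶ Y)
      have h3 := ConcreteCategory.congr_hom (NatTrans.congr_app hφ' (.op Y))
        ((factorThruImage (preadditiveYoneda.map f)).app (.op Y) (𝟙 Y : Y ⟶ Y))
      have h4 := congr_arg ((image.ι (preadditiveYoneda.map g)).app (.op Y)) hy
      have h5 : (y : Y ⟶ Z) ≫ g = (𝟙 Y : Y ⟶ Y) ≫ f :=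
        h1.symm.trans (h4.trans (h3.trans h2))
      simpa using h5
    · rintro ⟨h, rfl⟩
      let F : MonoFactorisation (preadditiveYoneda.map (h ≫ g)) :=
        { I := imageFunctor g
          m := image.ι (preadditiveYoneda.map g)
          e := preadditiveYoneda.map h ≫ factorThruImage (preadditiveYoneda.map g)
          fac := by simp }
      refine Subobject.mk_le_mk_of_comm ⟨image.lift F⟩ ?_
      ext1
      exact image.lift_fac F
  have := hN.noetherian A
  obtain ⟨_, ⟨⟨Y, f, hf⟩, rfl⟩, hmax⟩ := (wellFounded_gt (α := Subobject A)).has_min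
    (Set.range fun f : (Σ' (Y : D) (f : Y ⟶ X), P f) => Subobject.mk (i f.2.1))
    (by obtain ⟨Y, f, hf⟩ := hP; exact ⟨_, ⟨⟨Y, f, hf⟩, rfl⟩⟩)
  refine ⟨Y, f, hf, fun Z g hg h => ?_⟩
  have h1 := hmax _ ⟨⟨Z, g, hg⟩, rfl⟩
  have h2 := (hle f g).2 h
  exact (hle g f).1 (by
    by_contra h3
    exact h1 (lt_of_le_not_ge h2 h3))

end ImageFunctor

/-! ### Chain conditions on morphisms, and Fitting's lemma -/

section ChainConditions

variable {C : Type u} [Category.{v} C] [HasZeroObject C] [HasShift C ℤ]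
  [Preadditive C] [∀ n : ℤ, (shiftFunctor C n).Additive] [Pretriangulated C]

open Pretriangulated

variable (C) in
lemma hasWeakKernels : HasWeakKernels C := by
  intro Y X f
  obtain ⟨W, k, c, hT⟩ := distinguished_cocone_triangle₁ f
  refine ⟨W, k, comp_distTriang_mor_zero₁₂ _ hT, fun T t ht => ?_⟩
  obtain ⟨s, hs⟩ := Triangle.coyoneda_exact₂ _ hT t ht
  exact ⟨s, hs.symm⟩

variable (C) in
lemma hasWeakKernels_op : HasWeakKernels Cᵒᵖ := by
  intro Y X f
  obtain ⟨W, k, c, hT⟩ := distinguished_cocone_triangle f.unop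
  refine ⟨.op W, k.op, ?_, fun T t ht => ?_⟩
  · exact Quiver.Hom.unop_inj (comp_distTriang_mor_zero₁₂ _ hT)
  · obtain ⟨s, hs⟩ := Triangle.yoneda_exact₂ _ hT t.unop (by
      exact Quiver.Hom.op_inj ht)
    exact ⟨s.op, Quiver.Hom.unop_inj hs.symm⟩

variable (hfin : IsLocallyFinite C) (X : C)
include hfin

lemma IsLocallyFinite.exists_maximal_to (P : ∀ ⦃Y : C⦄, (Y ⟶ X) → Prop)
    (hP : ∃ (Y : C) (f : Y ⟶ X), P f) :
    ∃ (Y : C) (f : Y ⟶ X), P f ∧ ∀ ⦃Z : C⦄ (g : Z ⟶ X), P g → (∃ h, h ≫ g = f) →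
      ∃ h, h ≫ f = g :=
  exists_maximal_of_isLocallyNoetherian (hasWeakKernels C) hfin.locallyNoetherian X P hP

lemma IsLocallyFinite.exists_maximal_from (P : ∀ ⦃Y : C⦄, (X ⟶ Y) → Prop)
    (hP : ∃ (Y : C) (f : X ⟶ Y), P f) :
    ∃ (Y : C) (f : X ⟶ Y), P f ∧ ∀ ⦃Z : C⦄ (g : X ⟶ Z), P g → (∃ h, g ≫ h = f) →
      ∃ h, f ≫ h = g := by
  obtain ⟨Y₀, f₀, h₀⟩ := hP
  obtain ⟨Y, f, hf, hmax⟩ := exists_maximal_of_isLocallyNoetherian (hasWeakKernels_op C)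
    hfin.locallyNoetherian_op (.op X) (fun Y f => P f.unop) ⟨.op Y₀, f₀.op, h₀⟩
  refine ⟨Y.unop, f.unop, hf, fun Z g hg ⟨h, hh⟩ => ?_⟩
  obtain ⟨k, hk⟩ := hmax g.op hg ⟨h.op, Quiver.Hom.unop_inj hh⟩
  exact ⟨k.unop, Quiver.Hom.op_inj hk⟩

/-- Completing to a triangle `Y ⟶ X ⟶ W` reverses the factorisation order, so a maximal `X ⟶ W`
yields a minimal `Y ⟶ X`. -/
lemma IsLocallyFinite.exists_minimal_to (P : ∀ ⦃Y : C⦄, (Y ⟶ X) → Prop)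
    (hP : ∃ (Y : C) (f : Y ⟶ X), P f) :
    ∃ (Y : C) (f : Y ⟶ X), P f ∧ ∀ ⦃Z : C⦄ (g : Z ⟶ X), P g → (∃ h, h ≫ f = g) →
      ∃ h, h ≫ g = f := by
  obtain ⟨Y₀, f₀, h₀⟩ := hP
  obtain ⟨W₀, c₀, d₀, hT₀⟩ := distinguished_cocone_triangle f₀
  obtain ⟨W, c, ⟨Y, f, d, hf, hT⟩, hmax⟩ := hfin.exists_maximal_from X
    (fun W c => ∃ (Y : C) (f : Y ⟶ X) (d : W ⟶ Y⟦(1 : ℤ)⟧), P f ∧ Triangle.mk f c d ∈ distTriang C)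
    ⟨W₀, c₀, Y₀, f₀, d₀, h₀, hT₀⟩
  refine ⟨Y, f, hf, fun Z g hg ⟨h, hh⟩ => ?_⟩
  obtain ⟨W', c', d', hT'⟩ := distinguished_cocone_triangle g
  have hfc : f ≫ c = 0 := comp_distTriang_mor_zero₁₂ _ hT
  have hgc : g ≫ c' = 0 := comp_distTriang_mor_zero₁₂ _ hT'
  obtain ⟨u, hu⟩ := Triangle.yoneda_exact₂ _ hT' c
    (show g ≫ c = 0 by rw [← hh, Category.assoc, hfc, comp_zero])
  obtain ⟨k, hk⟩ := hmax c' ⟨Z, g, d', hg, hT'⟩ ⟨u, hu.symm⟩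
  obtain ⟨s, hs⟩ := Triangle.coyoneda_exact₂ _ hT' f
    (show f ≫ c' = 0 by rw [← hk, ← Category.assoc, hfc, zero_comp])
  exact ⟨s, hs.symm⟩

lemma IsLocallyFinite.exists_minimal_from (P : ∀ ⦃Y : C⦄, (X ⟶ Y) → Prop)
    (hP : ∃ (Y : C) (f : X ⟶ Y), P f) :
    ∃ (Y : C) (f : X ⟶ Y), P f ∧ ∀ ⦃Z : C⦄ (g : X ⟶ Z), P g → (∃ h, f ≫ h = g) →
      ∃ h, g ≫ h = f := by
  obtain ⟨Y₀, f₀, h₀⟩ := hP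
  obtain ⟨W₀, c₀, d₀, hT₀⟩ := distinguished_cocone_triangle₁ f₀
  obtain ⟨W, c, ⟨Y, f, d, hf, hT⟩, hmax⟩ := hfin.exists_maximal_to X
    (fun W c => ∃ (Y : C) (f : X ⟶ Y) (d : Y ⟶ W⟦(1 : ℤ)⟧), P f ∧ Triangle.mk c f d ∈ distTriang C)
    ⟨W₀, c₀, Y₀, f₀, d₀, h₀, hT₀⟩
  refine ⟨Y, f, hf, fun Z g hg ⟨h, hh⟩ => ?_⟩
  obtain ⟨W', c', d', hT'⟩ := distinguished_cocone_triangle₁ g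
  have hfc : c ≫ f = 0 := comp_distTriang_mor_zero₁₂ _ hT
  have hgc : c' ≫ g = 0 := comp_distTriang_mor_zero₁₂ _ hT'
  obtain ⟨u, hu⟩ := Triangle.coyoneda_exact₂ _ hT' c
    (show c ≫ g = 0 by rw [← hh, ← Category.assoc, hfc, zero_comp])
  obtain ⟨k, hk⟩ := hmax c' ⟨Z, g, d', hg, hT'⟩ ⟨u, hu.symm⟩
  obtain ⟨s, hs⟩ := Triangle.yoneda_exact₂ _ hT' f
    (show c' ≫ f = 0 by rw [← hk, Category.assoc, hfc, comp_zero])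
  exact ⟨s, hs.symm⟩

/-- Fitting's lemma: some power of an endomorphism `r` of `X` is an isomorphism onto a direct
summand of `X`. -/
lemma IsLocallyFinite.exists_fitting (r : End X) :
    ∃ (n : ℕ) (s t : End X), n ≠ 0 ∧ r ^ n = s * (r ^ n * r ^ n) ∧ r ^ n = (r ^ n * r ^ n) * t := by
  -- The source of the morphism varies in the chain condition; the equality `X = Y` restricts it to
  -- powers of `r`.
  obtain ⟨_, _, ⟨rfl, n, rfl⟩, hn⟩ := hfin.exists_minimal_to X
    (fun Y f => ∃ h : X = Y, ∃ n : ℕ, h ▸ f = r ^ n) ⟨X, r ^ 0, rfl, 0, rfl⟩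
  obtain ⟨_, _, ⟨rfl, m, rfl⟩, hm⟩ := hfin.exists_minimal_from X
    (fun Y f => ∃ h : X = Y, ∃ n : ℕ, h ▸ f = r ^ n) ⟨X, r ^ 0, rfl, 0, rfl⟩
  -- The exponent is chosen so that multiplying by `r ^ (m + 1)` gives `r ^ (2 * (n + m + 1))`; the
  -- `+ 1` keeps the final exponent nonzero.
  obtain ⟨t, ht⟩ : ∃ t : End X, r ^ (n + n + m + 1) * t = r ^ n :=
    hn (r ^ (n + n + m + 1)) ⟨rfl, _, rfl⟩ ⟨r ^ (n + m + 1), by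
      rw [← End.mul_def, ← pow_add]; congr 1; omega⟩
  obtain ⟨s, hs⟩ : ∃ s : End X, s * r ^ (m + m + n + 1) = r ^ m :=
    hm (r ^ (m + m + n + 1)) ⟨rfl, _, rfl⟩ ⟨r ^ (m + n + 1), by
      rw [← End.mul_def, ← pow_add]; congr 1; omega⟩
  refine ⟨n + m + 1, s, t, by omega, ?_, ?_⟩
  · calc r ^ (n + m + 1) = r ^ m * r ^ (n + 1) := by rw [← pow_add]; congr 1; omega
      _ = s * (r ^ (n + m + 1) * r ^ (n + m + 1)) := by
        rw [← hs, mul_assoc, ← pow_add, ← pow_add]; congr 2; omega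
  · calc r ^ (n + m + 1) = r ^ (m + 1) * r ^ n := by rw [← pow_add]; congr 1; omega
      _ = r ^ (n + m + 1) * r ^ (n + m + 1) * t := by
        rw [← ht, ← mul_assoc, ← pow_add, ← pow_add]; congr 2; omega

end ChainConditions

/-! ### Indecomposable objects and their local endomorphism rings -/

section Indecomposable

/-- If `x = s x² = x² t` then `s x` is an idempotent fixing `x`. -/
lemma isIdempotentElem_of_strongly_regular {R : Type*} [Monoid R] {x s t : R}
    (hs : x = s * (x * x)) (ht : x = (x * x) * t) :
    s * x = x * t ∧ IsIdempotentElem (s * x) ∧ x * (s * x) = x := by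
  have h1 : s * x = x * t := by
    conv_lhs => rw [ht]
    rw [← mul_assoc, ← hs]
  have h3 : x * (s * x) = x := by rw [h1, ← mul_assoc, ← ht]
  refine ⟨h1, ?_, h3⟩
  change s * x * (s * x) = s * x
  rw [mul_assoc, h3]

variable {C : Type u} [Category.{v} C] [Preadditive C]

/-- An object is indecomposable if it is nonzero and its only idempotent endomorphisms are
`0` and `1`. -/
structure IsIndecomposable (I : C) : Prop where
  id_ne_zero : 𝟙 I ≠ 0
  eq_zero_or_eq_id : ∀ p : I ⟶ I, p ≫ p = p → p = 0 ∨ p = 𝟙 I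

variable [HasZeroObject C] [HasShift C ℤ]
  [∀ n : ℤ, (shiftFunctor C n).Additive] [Pretriangulated C]

open Pretriangulated

/-- The endomorphism ring of an indecomposable object is local. -/
lemma IsIndecomposable.isUnit_or_isUnit_one_sub (hfin : IsLocallyFinite C) {I : C}
    (hI : IsIndecomposable I) (r : End I) : IsUnit r ∨ IsUnit (1 - r) := by
  obtain ⟨n, s, t, hn₀, hs, ht⟩ := hfin.exists_fitting I r
  obtain ⟨h1, h2, h4⟩ := isIdempotentElem_of_strongly_regular hs ht
  rcases hI.eq_zero_or_eq_id (s * r ^ n : End I) h2 with h | h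
  · right
    have hn : r ^ n = 0 := by
      rw [← h4]
      change r ^ n * (s * r ^ n : End I) = 0
      rw [show (s * r ^ n : End I) = 0 from h, mul_zero]
    exact IsNilpotent.isUnit_one_sub ⟨n, hn⟩
  · left
    exact (isUnit_pow_iff hn₀).1
      (isUnit_iff_exists_and_exists.2 ⟨⟨t, h1.symm.trans h⟩, ⟨s, h⟩⟩)

end Indecomposable

/-! ### Finitely many indecomposables under a given morphism -/

section Finiteness

variable {C : Type u} [Category.{v} C] [HasZeroObject C] [HasShift C ℤ]
  [Preadditive C] [∀ n : ℤ, (shiftFunctor C n).Additive] [Pretriangulated C]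

open Pretriangulated

/-- A nonzero morphism has a nonzero component in some indecomposable direct summand of its
target. -/
lemma IsLocallyFinite.exists_indecomposable_retract (hfin : IsLocallyFinite C) {X Z : C}
    (a : X ⟶ Z) (ha : a ≠ 0) :
    ∃ (I : C) (r : Retract I Z), IsIndecomposable I ∧ a ≫ r.r ≠ 0 := by
  -- The image of a minimal idempotent `e` with `a ≫ e ≠ 0` will be the indecomposable summand.
  obtain ⟨_, e, ⟨rfl, he, hae⟩, hmin⟩ := hfin.exists_minimal_to Z
    (fun Y e => ∃ h : Y = Z, (eqToHom h.symm ≫ e) ≫ (eqToHom h.symm ≫ e) = eqToHom h.symm ≫ e ∧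
      a ≫ eqToHom h.symm ≫ e ≠ 0) ⟨Z, 𝟙 Z, rfl, by simp, by simpa using ha⟩
  simp only [eqToHom_refl, Category.id_comp] at he hae
  have := hfin.locallyNoetherian.idempotents_split
  obtain ⟨I, i, π, hi, hπ⟩ := IsIdempotentComplete.idempotents_split _ e he
  have haπ : a ≫ π ≠ 0 := fun h => hae (by rw [← hπ, reassoc_of% h, zero_comp])
  have key (p : I ⟶ I) (hp : p ≫ p = p) (hap : a ≫ π ≫ p ≠ 0) : p = 𝟙 I := by
    obtain ⟨h, hh⟩ := hmin (π ≫ p ≫ i) ⟨rfl, by simp [reassoc_of% hi, reassoc_of% hp], fun h0 => by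
      apply hap
      simp only [eqToHom_refl, Category.id_comp] at h0
      simpa [hi] using h0 =≫ π⟩ ⟨π ≫ p ≫ i, by simp [← hπ, reassoc_of% hi]⟩
    have h1 : e ≫ π ≫ p ≫ i = e := by
      rw [← hh]
      simp [reassoc_of% hi, reassoc_of% hp]
    rw [← hπ] at h1
    simpa [reassoc_of% hi, hi] using i ≫= h1 =≫ π
  refine ⟨I, ⟨i, π, hi⟩, ⟨fun h => haπ ?_, fun p hp => ?_⟩, haπ⟩
  · rw [← Category.comp_id π, h, comp_zero, comp_zero]
  · by_cases h : a ≫ π ≫ p = 0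
    · left
      -- When `p` kills `a ≫ π`, the complement `𝟙 I - p` does not, so `key` applies to it.
      have h2 := key (𝟙 I - p) (by simp [Preadditive.sub_comp, Preadditive.comp_sub, hp])
        (by simpa [Preadditive.comp_sub, h] using haπ)
      simpa using h2
    · exact Or.inr (key p hp h)

/-- Up to isomorphism, there are only finitely many indecomposable objects receiving a nonzero
morphism which factors through `f`. -/
lemma IsLocallyFinite.finite_indecomposable_from (hfin : IsLocallyFinite C) {X Y : C}
    (f : X ⟶ Y) :
    ∃ s : Set C, s.Finite ∧ ∀ (I : C) (h : Y ⟶ I), IsIndecomposable I → f ≫ h ≠ 0 →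
      ∃ J ∈ s, Nonempty (I ≅ J) := by
  by_contra hf₀
  -- Minimal counterexample: the claim holds for each `f ≫ k` through which `f` does not factor
  -- back.
  obtain ⟨Y, f, hf, hmin⟩ := hfin.exists_minimal_from X
    (fun Y f => ¬ ∃ s : Set C, s.Finite ∧ ∀ (I : C) (h : Y ⟶ I), IsIndecomposable I →
      f ≫ h ≠ 0 → ∃ J ∈ s, Nonempty (I ≅ J)) ⟨Y, f, hf₀⟩
  have hf0 : f ≠ 0 := by
    rintro rfl
    exact hf ⟨∅, Set.finite_empty, fun I h _ hh => (hh zero_comp).elim⟩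
  -- `g` plays the role of a maximal proper subobject of the image of `f`; only one simple factor
  -- separates them.
  obtain ⟨Z, g, ⟨⟨k, hk⟩, hgf⟩, hmax⟩ := hfin.exists_maximal_from X
    (fun Z g => (∃ k, f ≫ k = g) ∧ ¬ ∃ k, g ≫ k = f)
    ⟨Y, 0, ⟨0, comp_zero⟩, fun ⟨k, hk⟩ => hf0 (by rw [← hk, zero_comp])⟩
  have hg : ∃ s : Set C, s.Finite ∧ ∀ (I : C) (h : Z ⟶ I), IsIndecomposable I →
      g ≫ h ≠ 0 → ∃ J ∈ s, Nonempty (I ≅ J) := by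
    by_contra hg
    exact hgf (hmin g hg ⟨k, hk⟩)
  obtain ⟨s, hs, hsg⟩ := hg
  -- Indecomposables detected by `f` but not by `g` are all isomorphic.
  have hcover {I : C} (a : Y ⟶ I) (ha : f ≫ a ≠ 0) (hI : ∀ h : Z ⟶ I, g ≫ h = 0) :
      ∃ (u : I ⟶ Y) (v : Z ⟶ Y), f = f ≫ a ≫ u + g ≫ v := by
    -- Otherwise `(f ≫ a, g)` is again proper, so by maximality it factors through `g`; then `f ≫ a`
    -- does too and vanishes.
    by_contra hcon
    obtain ⟨k', hk'⟩ := hmax (biprod.lift (f ≫ a) g)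
      ⟨⟨biprod.lift a k, by ext <;> simp [hk]⟩, fun ⟨k', hk'⟩ => hcon
        ⟨biprod.inl ≫ k', biprod.inr ≫ k', by
          rw [biprod.lift_eq, Preadditive.add_comp] at hk'
          simpa using hk'.symm⟩⟩
      ⟨biprod.snd, by simp⟩
    apply ha
    have := hk' =≫ biprod.fst
    simpa [hI] using this.symm
  have hiso {I J : C} (hI : IsIndecomposable I) (a : Y ⟶ I) (ha : f ≫ a ≠ 0)
      (hI0 : ∀ h : Z ⟶ I, g ≫ h = 0) (b : Y ⟶ J) (hb : f ≫ b ≠ 0)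
      (hJ0 : ∀ h : Z ⟶ J, g ≫ h = 0) :
      ∃ (α : I ⟶ J) (β : J ⟶ I), IsIso (α ≫ β) := by
    obtain ⟨u, v, huv⟩ := hcover a ha hI0
    obtain ⟨u', v', huv'⟩ := hcover b hb hJ0
    have h1 : f ≫ b = f ≫ a ≫ u ≫ b := by
      conv_lhs => rw [huv]
      simp [Preadditive.add_comp, hJ0]
    have h2 : f ≫ a = f ≫ b ≫ u' ≫ a := by
      conv_lhs => rw [huv']
      simp [Preadditive.add_comp, hI0]
    refine ⟨u ≫ b, u' ≫ a, ?_⟩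
    -- The round trip through `J` fixes `f ≫ a ≠ 0`, so `1` minus it is not invertible; locality
    -- makes the round trip itself invertible.
    rcases hI.isUnit_or_isUnit_one_sub hfin ((u ≫ b) ≫ (u' ≫ a) : I ⟶ I) with h | h
    · exact (isUnit_iff_isIso _).1 h
    · exfalso
      have h3 : IsIso (𝟙 I - (u ≫ b) ≫ (u' ≫ a)) := (isUnit_iff_isIso _).1 h
      apply ha
      rw [← cancel_mono (𝟙 I - (u ≫ b) ≫ (u' ≫ a)), zero_comp, Preadditive.comp_sub, sub_eq_zero,
        Category.comp_id]
      conv_lhs => rw [h2]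
      have := h1 =≫ (u' ≫ a)
      simpa using this
  apply hf
  -- Passing from `g` to `f` adds at most one isomorphism class.
  by_cases hex : ∃ (J : C) (b : Y ⟶ J), IsIndecomposable J ∧ f ≫ b ≠ 0 ∧ ∀ h : Z ⟶ J, g ≫ h = 0
  · obtain ⟨J, b, hJ, hb, hJ0⟩ := hex
    refine ⟨insert J s, hs.insert J, fun I a hI ha => ?_⟩
    by_cases hI0 : ∀ h : Z ⟶ I, g ≫ h = 0
    · obtain ⟨α, β, hαβ⟩ := hiso hI a ha hI0 b hb hJ0
      have hα : IsSplitMono α := ⟨⟨⟨β ≫ inv (α ≫ β), by rw [← Category.assoc]; simp⟩⟩⟩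
      refine ⟨J, Set.mem_insert _ _, ?_⟩
      -- the idempotent `β (αβ)⁻¹ α` of `J` is nonzero
      rcases hJ.eq_zero_or_eq_id (β ≫ inv (α ≫ β) ≫ α) (by
        simp only [Category.assoc]
        rw [← Category.assoc α β]; simp) with h | h
      · exfalso
        apply hI.id_ne_zero
        have := α ≫= h =≫ (β ≫ inv (α ≫ β))
        simp only [Category.assoc, zero_comp, comp_zero] at this
        rw [← Category.assoc α β, IsIso.hom_inv_id_assoc, ← Category.assoc α β,
          IsIso.hom_inv_id] at this
        exact this
      · exact ⟨⟨α, β ≫ inv (α ≫ β), by rw [← Category.assoc]; simp, by simpa using h⟩⟩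
    · push Not at hI0
      obtain ⟨h, hh⟩ := hI0
      obtain ⟨J', hJ', e⟩ := hsg I h hI hh
      exact ⟨J', Set.mem_insert_of_mem _ hJ', e⟩
  · push Not at hex
    refine ⟨s, hs, fun I a hI ha => ?_⟩
    obtain ⟨h, hh⟩ := hex I a hI ha
    exact hsg I h hI hh

end Finiteness

/-! ### Minimal right approximations and Wakamatsu's lemma -/

section Approximation

variable {C : Type u} [Category.{v} C] [HasZeroObject C] [HasShift C ℤ]
  [Preadditive C] [∀ n : ℤ, (shiftFunctor C n).Additive] [Pretriangulated C]

open Pretriangulated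

/-- `f` is a right approximation of `Z` by objects satisfying `P`. -/
structure IsRightApproximation (P : ObjectProperty C) {Y Z : C} (f : Y ⟶ Z) : Prop where
  prop : P Y
  exists_lift : ∀ ⦃W : C⦄ (g : W ⟶ Z), P W → ∃ h, h ≫ f = g

lemma IsThick.biprod {P : ObjectProperty C} (hP : IsThick P) {Y Z : C} (hY : P Y) (hZ : P Z) :
    P (Y ⊞ Z) := by
  have := hP.isTriangulated
  have := hP.retracts
  exact P.ext_of_isTriangulatedClosed₂ _ (binaryBiproductTriangle_distinguished Y Z) hY hZ

variable (hfin : IsLocallyFinite C) {P : ObjectProperty C} (hP : IsThick P)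
include hfin hP

/-- A maximal `f` among maps to `Z` from objects of `P` works: any other `g` is absorbed by
comparing `f` with `(f, g)` on the direct sum. -/
lemma IsLocallyFinite.exists_rightApproximation (Z : C) :
    ∃ (Y : C) (f : Y ⟶ Z), IsRightApproximation P f := by
  have := hP.isTriangulated
  obtain ⟨Y₀, -, h₀⟩ := P.exists_prop_of_containsZero
  obtain ⟨Y, f, hY, hmax⟩ := hfin.exists_maximal_to Z (fun Y _ => P Y) ⟨Y₀, 0, h₀⟩
  refine ⟨Y, f, hY, fun W g hW => ?_⟩
  obtain ⟨h, hh⟩ := hmax (biprod.desc f g) (hP.biprod hY hW) ⟨biprod.inl, by simp⟩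
  exact ⟨biprod.inr ≫ h, by simp [hh]⟩

/-- Restrict an approximation to the image of a minimal idempotent fixing it. By Fitting, an
endomorphism fixing the restriction has a power yielding an idempotent that also fixes it, hence the
identity. -/
lemma IsLocallyFinite.exists_minimal_rightApproximation (Z : C) :
    ∃ (Y : C) (f : Y ⟶ Z), IsRightApproximation P f ∧
      ∀ g : Y ⟶ Y, g ≫ f = f → IsIso g := by
  have := hP.retracts
  obtain ⟨Y, f, hf⟩ := hfin.exists_rightApproximation hP Z
  obtain ⟨_, e, ⟨rfl, he, hef⟩, hmin⟩ := hfin.exists_minimal_to Y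
    (fun W e => ∃ h : W = Y, (eqToHom h.symm ≫ e) ≫ (eqToHom h.symm ≫ e) = eqToHom h.symm ≫ e ∧
      (eqToHom h.symm ≫ e) ≫ f = f) ⟨Y, 𝟙 Y, rfl, by simp, by simp⟩
  simp only [eqToHom_refl, Category.id_comp] at he hef
  have := hfin.locallyNoetherian.idempotents_split
  obtain ⟨I, i, π, hi, hπ⟩ := IsIdempotentComplete.idempotents_split _ e he
  refine ⟨I, i ≫ f, ⟨P.prop_of_retract ⟨i, π, hi⟩ hf.prop, fun W g hW => ?_⟩, fun g hg => ?_⟩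
  · obtain ⟨h, hh⟩ := hf.exists_lift g hW
    exact ⟨h ≫ π, by rw [Category.assoc, reassoc_of% hπ, hef, hh]⟩
  · have hπf : π ≫ i ≫ f = f := by rw [reassoc_of% hπ, hef]
    have key (p : I ⟶ I) (hp : p ≫ p = p) (hpf : p ≫ i ≫ f = i ≫ f) : p = 𝟙 I := by
      obtain ⟨h, hh⟩ := hmin (π ≫ p ≫ i) ⟨rfl, by simp [reassoc_of% hi, reassoc_of% hp], by
        simp [hpf, hπf]⟩ ⟨π ≫ p ≫ i, by simp [← hπ, reassoc_of% hi]⟩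
      have h1 : e ≫ π ≫ p ≫ i = e := by
        rw [← hh]
        simp [reassoc_of% hi, reassoc_of% hp]
      rw [← hπ] at h1
      simpa [reassoc_of% hi, hi] using i ≫= h1 =≫ π
    let r : End I := g
    obtain ⟨n, s, t, hn₀, hs, ht⟩ := hfin.exists_fitting I r
    obtain ⟨h1, h2, h4⟩ := isIdempotentElem_of_strongly_regular hs ht
    have hrn (m : ℕ) : (r ^ m : End I) ≫ i ≫ f = i ≫ f := by
      induction m with
      | zero => exact Category.id_comp _
      | succ m ih =>
        rw [pow_succ', End.mul_def, Category.assoc, show r ≫ i ≫ f = i ≫ f from hg, ih]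
    have h5 := key (s * r ^ n : End I) h2 (by
      rw [← hrn n, ← Category.assoc, ← End.mul_def, h4])
    exact (isUnit_iff_isIso g).1 ((isUnit_pow_iff (a := r) hn₀).1
      (isUnit_iff_exists_and_exists.2 ⟨⟨t, h1.symm.trans h5⟩, ⟨s, h5⟩⟩))

/-- Wakamatsu's lemma: the cone of a minimal right approximation is right orthogonal to the
thick subcategory. -/
lemma IsLocallyFinite.exists_triangle_rightOrthogonal (Z : C) :
    ∃ (Y W : C) (f : Y ⟶ Z) (c : Z ⟶ W) (d : W ⟶ Y⟦(1 : ℤ)⟧),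
      Triangle.mk f c d ∈ distTriang C ∧ P Y ∧ ∀ ⦃V : C⦄ (g : V ⟶ W), P V → g = 0 := by
  have := hP.isTriangulated
  have := hP.retracts
  obtain ⟨Y, f, hf, hmin⟩ := hfin.exists_minimal_rightApproximation hP Z
  obtain ⟨W, c, d, hT⟩ := distinguished_cocone_triangle f
  refine ⟨Y, W, f, c, d, hT, hf.prop, fun V g hV => ?_⟩
  -- The extension `Y ⟶ E ⟶ V` with class `g ≫ d` lies in `P`. Through it `f` extends along `a` and
  -- lifts back to `Y`; minimality then splits `a`, so `g ≫ d = 0`.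
  obtain ⟨E, a, b, hT'⟩ := distinguished_cocone_triangle₂ (g ≫ d)
  have hE : P E := P.ext_of_isTriangulatedClosed₂ _ hT' hf.prop hV
  obtain ⟨φ, hφ⟩ : ∃ φ : E ⟶ Z, a ≫ φ = f := by
    obtain ⟨φ, hφ, -⟩ := complete_distinguished_triangle_morphism₂ _ _ hT' hT (𝟙 Y) g
      (show (g ≫ d) ≫ (𝟙 Y)⟦(1 : ℤ)⟧' = g ≫ d by
        rw [CategoryTheory.Functor.map_id, Category.comp_id])
    exact ⟨φ, hφ.trans (Category.id_comp f)⟩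
  obtain ⟨ψ, hψ⟩ := hf.exists_lift φ hE
  have hiso := hmin (a ≫ ψ) (by rw [Category.assoc, hψ, hφ])
  have ha : Mono a := mono_of_mono a ψ
  have hgd : g ≫ d = 0 := (Triangle.mor₃_eq_zero_iff_mono₁ _ hT').2 ha
  obtain ⟨k, hk⟩ : ∃ k : V ⟶ Z, g = k ≫ c := Triangle.coyoneda_exact₃ _ hT g hgd
  obtain ⟨l, hl⟩ := hf.exists_lift k hV
  have hfc : f ≫ c = 0 := comp_distTriang_mor_zero₁₂ _ hT
  rw [hk, ← hl, Category.assoc, hfc, comp_zero]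

end Approximation

/-! ### Detecting objects by the generator and comparing thick subcategories -/

section Generation

variable {C : Type u} [Category.{v} C] [HasZeroObject C] [HasShift C ℤ]
  [Preadditive C] [∀ n : ℤ, (shiftFunctor C n).Additive] [Pretriangulated C]

open Pretriangulated

/-- The objects admitting no nonzero morphism to any shift of `W` form a thick subcategory. -/
lemma isThick_leftOrthogonal (W : C) :
    IsThick (fun Z : C => ∀ (n : ℤ) (f : Z ⟶ W⟦n⟧), f = 0) := by
  set P : ObjectProperty C := fun Z : C => ∀ (n : ℤ) (f : Z ⟶ W⟦n⟧), f = 0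
  have hret : P.IsStableUnderRetracts := ⟨fun {Y Z} r hZ n f => by
    have := hZ n (r.r ≫ f)
    rw [← Category.id_comp f, ← r.retract, Category.assoc, this, comp_zero]⟩
  refine ⟨?_, hret⟩
  have h1 : P.ContainsZero := ⟨_, isZero_zero C, fun n f => (isZero_zero C).eq_of_src _ _⟩
  have h2 : P.IsStableUnderShift ℤ := ⟨fun a => ⟨fun Z hZ n f => by
    have h := hZ (n + -a) ((shiftShiftNeg Z a).inv ≫ f⟦-a⟧' ≫
      (shiftFunctorAdd C n (-a)).inv.app W)
    rw [← Category.assoc, Preadditive.IsIso.comp_right_eq_zero,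
      Preadditive.IsIso.comp_left_eq_zero] at h
    exact (shiftFunctor C (-a)).map_injective (by rw [h, Functor.map_zero])⟩⟩
  have h3 : P.IsTriangulatedClosed₂ := .mk' fun T hT hT₁ hT₃ n f => by
    obtain ⟨g, hg⟩ := Triangle.yoneda_exact₂ T hT f (hT₁ n _)
    rw [hg, hT₃ n g, comp_zero]
  exact {}

/-- Otherwise `X` lies in the thick left orthogonal of the shifts of `W`, which then contains `W`
itself. -/
lemma IsFinitelyGenerated.exists_ne_zero {X : C}
    (hX : thickClosure (ObjectProperty.singleton X) = ⊤) {W : C} (hW : 𝟙 W ≠ 0) :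
    ∃ (n : ℤ) (f : X ⟶ W⟦n⟧), f ≠ 0 := by
  by_contra! h
  have hW' : thickClosure (ObjectProperty.singleton X) W := by rw [hX]; trivial
  have h0 := hW' _ (isThick_leftOrthogonal W) (by
    rintro _ ⟨⟩
    exact h) 0 ((shiftFunctorZero C ℤ).inv.app W)
  apply hW
  have h1 := Iso.inv_hom_id_app (shiftFunctorZero C ℤ) W
  rw [h0, zero_comp] at h1
  exact h1.symm

lemma IsThick.inf {P Q : ObjectProperty C} (hP : IsThick P) (hQ : IsThick Q) :
    IsThick (P ⊓ Q) := by
  have := hP.isTriangulated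
  have := hQ.isTriangulated
  have := hP.retracts
  have := hQ.retracts
  exact ⟨inferInstance, ⟨fun r h => ⟨P.prop_of_retract r h.1, Q.prop_of_retract r h.2⟩⟩⟩

/-- Thick subcategories `Q ≤ P` agree if they contain the same indecomposables which receive a
nonzero morphism from a given generator. -/
lemma IsThick.le_of_indecomposable {X : C}
    (hX : thickClosure (ObjectProperty.singleton X) = ⊤) (hfin : IsLocallyFinite C)
    {P Q : ObjectProperty C} (hP : IsThick P) (hQ : IsThick Q) (hQP : Q ≤ P)
    (h : ∀ (I : C) (f : X ⟶ I), IsIndecomposable I → f ≠ 0 → P I → Q I) : P ≤ Q := by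
  intro Z hZ
  have := hP.isTriangulated
  have := hQ.isTriangulated
  have := hP.retracts
  have := hQ.retracts
  obtain ⟨Y, W, f, c, d, hT, hY, hW⟩ := hfin.exists_triangle_rightOrthogonal hQ Z
  have hPW : P W := P.ext_of_isTriangulatedClosed₃ _ hT (hQP _ hY) hZ
  have hW0 : 𝟙 W = 0 := by
    by_contra hne
    obtain ⟨n, a, ha⟩ := IsFinitelyGenerated.exists_ne_zero hX hne
    obtain ⟨I, r, hI, hr⟩ := hfin.exists_indecomposable_retract a ha
    have hQI := h I _ hI hr (P.prop_of_retract r (P.le_shift n _ hPW))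
    apply hI.id_ne_zero
    -- The summand `I` of `W⟦n⟧` lies in `Q`, so after shifting by `-n` its inclusion becomes a map
    -- from `Q` to `W`.
    have hi : r.i = 0 := by
      have h0 := hW (r.i⟦-n⟧' ≫ (shiftShiftNeg W n).hom) (Q.le_shift (-n) _ hQI)
      rw [Preadditive.IsIso.comp_right_eq_zero] at h0
      exact (shiftFunctor C (-n)).map_injective (by rw [h0, Functor.map_zero])
    rw [← r.retract, hi, zero_comp]
  have : IsIso f := (Triangle.isZero₃_iff_isIso₁ _ hT).1 ((IsZero.iff_id_eq_zero W).2 hW0)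
  exact Q.prop_of_iso (asIso f) hY

end Generation

end LocFinTriang

theorem proposition4p4 (C : Type u) [Category.{v} C] [HasZeroObject C] [HasShift C ℤ]
    [Preadditive C] [∀ n : ℤ, (shiftFunctor C n).Additive] [Pretriangulated C]
    [IsTriangulated C] [EssentiallySmall.{w} C]
    (hgen : LocFinTriang.IsFinitelyGenerated C)
    (hfin : LocFinTriang.IsLocallyFinite C) :
    Finite {P : ObjectProperty C // LocFinTriang.IsThick P} := by
  obtain ⟨X, hX⟩ := hgen
  obtain ⟨s, hs, hsX⟩ := hfin.finite_indecomposable_from (𝟙 X)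
  have := hs.to_subtype
  refine Finite.of_injective
    (fun P : {P : ObjectProperty C // LocFinTriang.IsThick P} => {J : s | P.1 J}) ?_
  have key (P Q : {P : ObjectProperty C // LocFinTriang.IsThick P})
      (hPQ : {J : s | P.1 J} = {J : s | Q.1 J}) : P.1 ≤ Q.1 := by
    -- `P` and `Q` need not be nested, so `P` is compared with `P ⊓ Q`.
    refine le_trans (LocFinTriang.IsThick.le_of_indecomposable hX hfin P.2 (P.2.inf Q.2)
      inf_le_left fun I f hI hf hPI => ⟨hPI, ?_⟩) inf_le_right
    have := P.2.retracts
    have := Q.2.retracts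
    obtain ⟨J, hJ, ⟨e⟩⟩ := hsX I f hI (by simpa using hf)
    have hJQ : (⟨J, hJ⟩ : s) ∈ {J : s | Q.1 J} := hPQ ▸ P.1.prop_of_iso e hPI
    exact Q.1.prop_of_iso e.symm hJQ
  intro P Q hPQ
  exact Subtype.ext (le_antisymm (key P Q hPQ) (key Q P hPQ.symm))
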